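/- For $d\in\mathbb N$ let $\mathbb B^d$ be the closed Euclidean unit ball of $\mathbb R^d$. For $P\subseteq\mathbb R^d$ compact let $R(P,\mathbb B^d)$ denote the least $\rho\ge 0$ such that $P\subseteq c+\rho\,\mathbb B^d$ for some $c\in\mathbb R^d$, and for $\varepsilon\ge 0$ call a subset $S\subseteq P$ an $\varepsilon$-core-set of $P$ (with respect to $\mathbb B^d$) if $R(S,\mathbb B^d)\le R(P,\mathbb B^d)\le(1+\varepsilon)R(S,\mathbb B^d)$, where $R(S,\mathbb B^d)$ is the infimum of the $\rho\ge 0$ such that $S\subseteq c+\rho\,\mathbb B^d$ for some $c\in\mathbb R^d$. **Theorem (size of $\varepsilon$-core-sets for the minimal enclosing ball).** Let $\varepsilon>0$ and $N(\varepsilon)=\left\lceil\frac{1}{2\varepsilon+\varepsilon^2}\right\rceil+1$. 1. For every $d$ and every compact $P\subseteq\mathbb R^d$ there exists an $\varepsilon$-core-set of $P$ with respect to $\mathbb B^d$ of size at most $N(\varepsilon)$. 2. This is the best possible bound that is independent of $d$: if $m\in\mathbb N$ is such that, for every $d$, every compact $P\subseteq\mathbb R^d$ has an $\varepsilon$-core-set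 with respect to $\mathbb B^d$ of size at most $m$, then $m\ge N(\varepsilon)$. 3. The sharpness is witnessed by regular simplices in high dimension: there is $D$ (depending only on $\varepsilon$) such that for every $d\ge D$ regular $d$-simplices (convex hulls of the $d+1$ vertices) in $\mathbb R^d$ exist, and for each regular $d$-simplex $T\subseteq\mathbb R^d$ every $\varepsilon$-core-set of $T$ with respect to $\mathbb B^d$ has at least $N(\varepsilon)$ points. -/

import Mathlib

open scoped Pointwise

/-- The `C`-radius `R(P, C)` of `P`: the least `ρ ≥ 0` such that some translate `c + ρ C` contains
`P`. (For bounded `P` and a full-dimensional compact convex `C` the set below is nonempty and the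
infimum is attained.) -/
noncomputable def containmentRadius {d : ℕ} (P C : Set (EuclideanSpace ℝ (Fin d))) : ℝ :=
  sInf {ρ : ℝ | 0 ≤ ρ ∧ ∃ c : EuclideanSpace ℝ (Fin d), P ⊆ c +ᵥ ρ • C}

/-- `S` is an `ε`-core-set of `P` with respect to the container `C`. -/
def IsCoreSet {d : ℕ} (ε : ℝ) (C P S : Set (EuclideanSpace ℝ (Fin d))) : Prop :=
  S ⊆ P ∧ containmentRadius S C ≤ containmentRadius P C ∧
    containmentRadius P C ≤ (1 + ε) * containmentRadius S C

/-- The Euclidean unit ball of `ℝ^d`. -/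
def unitBall (d : ℕ) : Set (EuclideanSpace ℝ (Fin d)) :=
  Metric.closedBall 0 1

/-- `T` is a regular `d`-simplex in `ℝ^d`: the convex hull of the vertices of a regular simplex. -/
def IsRegularSimplex {d : ℕ} (T : Set (EuclideanSpace ℝ (Fin d))) : Prop :=
  ∃ s : Affine.Simplex ℝ (EuclideanSpace ℝ (Fin d)) d,
    s.Regular ∧ T = convexHull ℝ (Set.range s.points)

/-! By duality the squared radius of the minimal enclosing ball of `P` is the largest variance `z -
‖y‖ ^ 2` of a probability distribution on `P`, that is, of a point `(y, z)` in the hull of the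
paraboloid lift. The optimal mean `y` is the centre. Upper bound: `k + 1` independent samples have
expected empirical variance `k / (k + 1)` times the variance. Greedy choice derandomizes this, and
empirical variance bounds the squared radius of any enclosing ball from below. So `k + 1` points
suffice once `(1 + ε) ^ 2 * k / (k + 1) ≥ 1`, i.e. `k ≥ 1 / (2 * ε + ε ^ 2)`. Lower bound: in a
simplex of edge `a`, any `k` points have pairwise distances at most `a`, so squared radius at most
`a ^ 2 / 2 * (1 - 1 / k)`. The simplex itself has `a ^ 2 / 2 * (1 - 1 / (d + 1))`, which is too
large when `d` is large. -/

open scoped RealInnerProductSpace in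
-- An average of a linear functional of the lift is at most its maximum over `P`; this derandomizes
-- the sampling.
theorem exists_le_of_mem_closure_convexHull_graph {E : Type*} [NormedAddCommGroup E]
    [InnerProductSpace ℝ E] {P : Set E} (hP : IsCompact P) (hne : P.Nonempty) {y : E} {z : ℝ}
    (h : (y, z) ∈ closure (convexHull ℝ ((fun x : E => (x, ‖x‖ ^ 2)) '' P))) (a : E) (b : ℝ) :
    ∃ x ∈ P, b * z + ⟪a, y⟫ ≤ b * ‖x‖ ^ 2 + ⟪a, x⟫ := by
  obtain ⟨x, hx, hmax⟩ := hP.exists_isMaxOn hne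
    (f := fun x : E => b * ‖x‖ ^ 2 + ⟪a, x⟫) (by fun_prop)
  refine ⟨x, hx, ?_⟩
  have hcl : IsClosed {q : E × ℝ | b * q.2 + ⟪a, q.1⟫ ≤ b * ‖x‖ ^ 2 + ⟪a, x⟫} :=
    isClosed_le (by fun_prop) (by fun_prop)
  have hconv : Convex ℝ {q : E × ℝ | b * q.2 + ⟪a, q.1⟫ ≤ b * ‖x‖ ^ 2 + ⟪a, x⟫} := by
    intro q hq r hr s t hs ht hst
    simp only [Set.mem_ofPred_eq, Prod.snd_add, Prod.fst_add, Prod.smul_fst, Prod.smul_snd,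
      inner_add_right, inner_smul_right, smul_eq_mul] at *
    have h1 := mul_le_mul_of_nonneg_left hq hs
    have h2 := mul_le_mul_of_nonneg_left hr ht
    have h3 : s * (b * ‖x‖ ^ 2 + ⟪a, x⟫) + t * (b * ‖x‖ ^ 2 + ⟪a, x⟫) =
        b * ‖x‖ ^ 2 + ⟪a, x⟫ := by rw [← add_mul, hst, one_mul]
    linarith
  have hsub : (fun x : E => (x, ‖x‖ ^ 2)) '' P ⊆
      {q : E × ℝ | b * q.2 + ⟪a, q.1⟫ ≤ b * ‖x‖ ^ 2 + ⟪a, x⟫} := by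
    rintro _ ⟨p, hp, rfl⟩
    exact hmax hp
  exact closure_minimal (convexHull_min hsub hconv) hcl h

/-- Duality for the minimal enclosing ball: its centre and squared radius arise from a point of the
closed convex hull of the lift of `P` to the paraboloid. -/
theorem exists_enclosing_ball_of_isCompact {E : Type*} [NormedAddCommGroup E]
    [InnerProductSpace ℝ E] [CompleteSpace E] {P : Set E} (hP : IsCompact P) (hne : P.Nonempty) :
    ∃ (y : E) (z : ℝ), (y, z) ∈ closure (convexHull ℝ ((fun x : E => (x, ‖x‖ ^ 2)) '' P)) ∧
      ∀ p ∈ P, ‖p - y‖ ^ 2 ≤ z - ‖y‖ ^ 2 := by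
  set Q := (fun x : E => (x, ‖x‖ ^ 2)) '' P
  have hQc : IsCompact Q := hP.image (by fun_prop)
  have hK : IsCompact (closure (convexHull ℝ Q)) :=
    isCompact_iff_totallyBounded_isComplete.2
      ⟨(totallyBounded_convexHull.2 hQc.totallyBounded).closure, isClosed_closure.isComplete⟩
  obtain ⟨⟨y, z⟩, hmem, hmax⟩ := hK.exists_isMaxOn
    ((hne.image _).mono ((subset_convexHull ℝ Q).trans subset_closure))
    (f := fun q : E × ℝ => q.2 - ‖q.1‖ ^ 2) (by fun_prop)
  refine ⟨y, z, hmem, fun p hp => ?_⟩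
  have hpK : (p, ‖p‖ ^ 2) ∈ closure (convexHull ℝ Q) :=
    subset_closure (subset_convexHull ℝ Q ⟨p, hp, rfl⟩)
  -- Moving a fraction `t` from the maximizer towards the lift of `p` cannot raise the variance;
  -- divide by `t`, then let `t` tend to `0`.
  have key : ∀ t ∈ Set.Ioc (0 : ℝ) 1,
      ‖p - y‖ ^ 2 - (z - ‖y‖ ^ 2) ≤ t * ‖p - y‖ ^ 2 := by
    rintro t ⟨ht0, ht1⟩
    have hc := (convex_convexHull ℝ Q).closure hmem hpK (sub_nonneg.2 ht1) ht0.le (by ring)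
    have h1 := hmax hc
    simp only [Set.mem_ofPred_eq, Prod.snd_add, Prod.fst_add, Prod.smul_fst, Prod.smul_snd,
      smul_eq_mul] at h1
    have h2 : ‖(1 - t) • y + t • p‖ ^ 2 =
        (1 - t) * ‖y‖ ^ 2 + t * ‖p‖ ^ 2 - t * (1 - t) * ‖p - y‖ ^ 2 := by
      rw [norm_add_sq_real, norm_sub_sq_real, norm_smul, norm_smul, inner_smul_left,
        inner_smul_right, mul_pow, mul_pow, Real.norm_eq_abs, Real.norm_eq_abs, sq_abs, sq_abs,
        real_inner_comm p y]
      simp only [conj_trivial]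
      ring
    rw [h2] at h1
    refine le_of_mul_le_mul_left ?_ ht0
    linarith
  have hlim : Filter.Tendsto (fun t : ℝ => t * ‖p - y‖ ^ 2) (nhdsWithin 0 (Set.Ioi 0))
      (nhds 0) := by
    have : Filter.Tendsto (fun t : ℝ => t * ‖p - y‖ ^ 2) (nhds 0) (nhds (0 * ‖p - y‖ ^ 2)) :=
      (continuous_id.mul continuous_const).tendsto 0
    rw [zero_mul] at this
    exact this.mono_left nhdsWithin_le_nhds
  have := ge_of_tendsto hlim (Filter.eventually_of_mem (Ioc_mem_nhdsGT one_pos) key)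
  linarith

/-! ### Small subsets of large radius -/

/-- Greedy selection of points whose spread is at least that of independent samples. -/
theorem exists_tuple_spread_ge {E : Type*} [NormedAddCommGroup E]
    [InnerProductSpace ℝ E] {P : Set E} (hP : IsCompact P) (hne : P.Nonempty) {y : E} {z : ℝ}
    (h : (y, z) ∈ closure (convexHull ℝ ((fun x : E => (x, ‖x‖ ^ 2)) '' P))) (α : ℝ) (n : ℕ) :
    ∃ f : Fin n → E, (∀ i, f i ∈ P) ∧
      n * ((1 - α) * (z - ‖y‖ ^ 2)) ≤ ∑ i, ‖f i - y‖ ^ 2 - α * ‖∑ i, (f i - y)‖ ^ 2 := by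
  induction n with
  | zero => exact ⟨Fin.elim0, fun i => i.elim0, by simp⟩
  | succ n ih =>
    obtain ⟨f, hf, hle⟩ := ih
    set s := ∑ i, (f i - y)
    -- Up to a constant, this functional is the increment `(1 - α) * ‖x - y‖ ^ 2 - 2 * α * ⟪s, x -
    -- y⟫` of the spread; at `(y, z)` the cross term vanishes.
    obtain ⟨x, hx, hxle⟩ := exists_le_of_mem_closure_convexHull_graph hP hne h
      (-(2 * (1 - α)) • y - (2 * α) • s) (1 - α)
    refine ⟨Fin.cons x f, fun i => ?_, ?_⟩
    · refine Fin.cases ?_ (fun j => ?_) i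
      · simpa using hx
      · simpa using hf j
    · simp only [Fin.sum_univ_succ, Fin.cons_zero, Fin.cons_succ]
      rw [norm_add_sq_real (x - y) s]
      simp only [inner_sub_left, inner_smul_left, conj_trivial,
        norm_sub_sq_real x y] at hxle ⊢
      rw [real_inner_self_eq_norm_sq] at hxle
      rw [real_inner_comm x y, real_inner_comm x s, real_inner_comm y s] at hxle
      push_cast
      linarith

/-- The weighted variance about an arbitrary point, in terms of pairwise distances. -/
theorem sum_mul_norm_sub_sq_sub {ι E : Type*} [NormedAddCommGroup E] [InnerProductSpace ℝ E]
    (t : Finset ι) (w : ι → ℝ) (x : ι → E) (hw : ∑ i ∈ t, w i = 1) (c : E) :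
    ∑ i ∈ t, w i * ‖x i - c‖ ^ 2 - ‖∑ i ∈ t, w i • (x i - c)‖ ^ 2 =
      (∑ i ∈ t, ∑ j ∈ t, w i * w j * ‖x i - x j‖ ^ 2) / 2 := by
  have h1 : ‖∑ i ∈ t, w i • (x i - c)‖ ^ 2 =
      ∑ i ∈ t, ∑ j ∈ t, w i * w j * inner ℝ (x i - c) (x j - c) := by
    rw [← real_inner_self_eq_norm_sq, sum_inner]
    refine Finset.sum_congr rfl fun i _ => ?_
    rw [inner_sum]
    refine Finset.sum_congr rfl fun j _ => ?_
    rw [inner_smul_left, inner_smul_right, conj_trivial, mul_assoc]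
  have h2 : ∑ i ∈ t, ∑ j ∈ t, w i * w j * ‖x i - x j‖ ^ 2 =
      ∑ i ∈ t, ∑ j ∈ t, (w j * (w i * ‖x i - c‖ ^ 2) + w i * (w j * ‖x j - c‖ ^ 2)
        - 2 * (w i * w j * inner ℝ (x i - c) (x j - c))) := by
    refine Finset.sum_congr rfl fun i _ => Finset.sum_congr rfl fun j _ => ?_
    rw [← sub_sub_sub_cancel_right (x i) (x j) c, norm_sub_sq_real]
    ring
  rw [h1, h2]
  simp only [Finset.sum_add_distrib, Finset.sum_sub_distrib, ← Finset.mul_sum, ← Finset.sum_mul, hw]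
  ring

theorem containmentRadius_unitBall_le {d : ℕ} {P : Set (EuclideanSpace ℝ (Fin d))}
    {c : EuclideanSpace ℝ (Fin d)} {ρ : ℝ} (hρ : 0 ≤ ρ) (h : P ⊆ Metric.closedBall c ρ) :
    containmentRadius P (unitBall d) ≤ ρ := by
  refine csInf_le ⟨0, fun x hx => hx.1⟩ ⟨hρ, c, ?_⟩
  rwa [unitBall, affinity_unitClosedBall hρ]

theorem le_containmentRadius_unitBall {d : ℕ} {P : Set (EuclideanSpace ℝ (Fin d))}
    (hP : Bornology.IsBounded P) {r : ℝ}
    (h : ∀ c ρ, 0 ≤ ρ → P ⊆ Metric.closedBall c ρ → r ≤ ρ) :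
    r ≤ containmentRadius P (unitBall d) := by
  refine le_csInf ?_ ?_
  · obtain ⟨ρ, hρ, h0⟩ := hP.subset_closedBall_lt 0 0
    exact ⟨ρ, hρ.le, 0, by rwa [unitBall, affinity_unitClosedBall hρ.le]⟩
  · rintro ρ ⟨hρ, c, hc⟩
    rw [unitBall, affinity_unitClosedBall hρ] at hc
    exact h c ρ hρ hc

theorem containmentRadius_unitBall_nonneg {d : ℕ} (P : Set (EuclideanSpace ℝ (Fin d))) :
    0 ≤ containmentRadius P (unitBall d) :=
  Real.sInf_nonneg fun _ hx => hx.1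

theorem containmentRadius_unitBall_mono {d : ℕ} {S P : Set (EuclideanSpace ℝ (Fin d))}
    (hP : Bornology.IsBounded P) (h : S ⊆ P) :
    containmentRadius S (unitBall d) ≤ containmentRadius P (unitBall d) :=
  le_containmentRadius_unitBall hP fun _ _ hρ hc => containmentRadius_unitBall_le hρ (h.trans hc)

/-- Every nonempty compact set contains `k + 1` points whose enclosing balls are almost as large as
its own. -/
theorem exists_subset_containmentRadius_ge {d : ℕ} {P : Set (EuclideanSpace ℝ (Fin d))}
    (hP : IsCompact P) (hne : P.Nonempty) (k : ℕ) :
    ∃ S ⊆ P, S.encard ≤ ((k + 1 : ℕ) : ℕ∞) ∧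
      √(k / (k + 1)) * containmentRadius P (unitBall d) ≤ containmentRadius S (unitBall d) := by
  obtain ⟨y, z, hmem, hball⟩ := exists_enclosing_ball_of_isCompact hP hne
  obtain ⟨f, hf, hspread⟩ := exists_tuple_spread_ge hP hne hmem (1 / (k + 1)) (k + 1)
  have hsub : Set.range f ⊆ P := Set.range_subset_iff.2 hf
  have hk : (0 : ℝ) < k + 1 := by positivity
  have hradius : containmentRadius P (unitBall d) ≤ √(z - ‖y‖ ^ 2) := by
    refine containmentRadius_unitBall_le (c := y) (Real.sqrt_nonneg _) fun p hp => ?_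
    rw [mem_closedBall_iff_norm]
    exact Real.le_sqrt_of_sq_le (hball p hp)
  refine ⟨Set.range f, hsub, ?_, ?_⟩
  · rw [← Set.image_univ]
    refine (Set.encard_image_le f Set.univ).trans ?_
    simp [Set.encard_univ]
  · refine (mul_le_mul_of_nonneg_left hradius (Real.sqrt_nonneg _)).trans ?_
    rw [← Real.sqrt_mul (by positivity)]
    refine le_containmentRadius_unitBall (hP.isBounded.subset hsub) fun c ρ hρ hc => ?_
    refine Real.sqrt_le_iff.2 ⟨hρ, ?_⟩
    have hw : ∑ _i : Fin (k + 1), (1 / (k + 1) : ℝ) = 1 := by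
      simp; field_simp
    have hy := sum_mul_norm_sub_sq_sub Finset.univ (fun _ => (1 / (k + 1) : ℝ)) f hw y
    have hc' := sum_mul_norm_sub_sq_sub Finset.univ (fun _ => (1 / (k + 1) : ℝ)) f hw c
    -- The variances about `y` and about `c` agree, both being given by pairwise distances.
    rw [← hc', ← Finset.smul_sum, ← Finset.mul_sum, norm_smul, mul_pow, Real.norm_eq_abs,
      sq_abs] at hy
    have hle : ∑ i : Fin (k + 1), (1 / (k + 1) : ℝ) * ‖f i - c‖ ^ 2 ≤ ρ ^ 2 := by
      calc _ ≤ ∑ i : Fin (k + 1), (1 / (k + 1) : ℝ) * ρ ^ 2 := by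
            gcongr with i
            exact mem_closedBall_iff_norm.1 (hc ⟨i, rfl⟩)
        _ = ρ ^ 2 := by rw [← Finset.sum_mul, hw, one_mul]
    have hsq := sq_nonneg ‖∑ i, (1 / (k + 1) : ℝ) • (f i - c)‖
    have h3 := mul_le_mul_of_nonneg_left hspread (by positivity : (0 : ℝ) ≤ 1 / (k + 1))
    have h4 : (1 / (k + 1) : ℝ) * (((k + 1 : ℕ) : ℝ) * ((1 - 1 / (k + 1)) * (z - ‖y‖ ^ 2))) =
        k / (k + 1) * (z - ‖y‖ ^ 2) := by
      push_cast; field_simp; ring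
    rw [h4] at h3
    linarith

/-! ### Radii of finite sets and of regular simplices -/

/-- A sharpened Jung inequality: the enclosing ball of at most `k` points in terms of their
pairwise distances. -/
theorem containmentRadius_finset_le {d : ℕ} (S : Finset (EuclideanSpace ℝ (Fin d)))
    (hne : S.Nonempty) {a : ℝ} (hdist : ∀ x ∈ S, ∀ y ∈ S, dist x y ≤ a) :
    containmentRadius (S : Set (EuclideanSpace ℝ (Fin d))) (unitBall d) ≤
      √(a ^ 2 / 2 * (1 - 1 / S.card)) := by
  classical
  obtain ⟨y, z, hmem, hball⟩ := exists_enclosing_ball_of_isCompact S.finite_toSet.isCompact hne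
  have hfin := S.finite_toSet.image (fun x : EuclideanSpace ℝ (Fin d) => (x, ‖x‖ ^ 2))
  rw [(hfin.isClosed_convexHull ℝ).closure_eq, ← Finset.coe_image, Finset.mem_convexHull'] at hmem
  obtain ⟨w, hw0, hw1, hwy⟩ := hmem
  have hinj : Set.InjOn (fun x : EuclideanSpace ℝ (Fin d) => (x, ‖x‖ ^ 2)) S :=
    fun x _ x' _ h => congrArg Prod.fst h
  rw [Finset.sum_image hinj] at hw1 hwy
  set v : EuclideanSpace ℝ (Fin d) → ℝ := fun x => w (x, ‖x‖ ^ 2)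
  have hv0 : ∀ x ∈ S, 0 ≤ v x := fun x hx => hw0 _ (Finset.mem_image_of_mem _ hx)
  have hyv : ∑ x ∈ S, v x • x = y := by simpa [Prod.fst_sum] using congrArg Prod.fst hwy
  have hzv : ∑ x ∈ S, v x * ‖x‖ ^ 2 = z := by simpa [Prod.snd_sum] using congrArg Prod.snd hwy
  have hvar := sum_mul_norm_sub_sq_sub S v id hw1 0
  simp only [id, sub_zero, hyv, hzv] at hvar
  -- Cauchy–Schwarz: the diagonal terms, which contribute no distance, have total weight at least `1
  -- / S.card`.
  have hcs : 1 / (S.card : ℝ) ≤ ∑ x ∈ S, v x ^ 2 := by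
    have := sq_sum_le_card_mul_sum_sq (s := S) (f := v)
    rw [hw1, one_pow] at this
    rw [div_le_iff₀' (by exact_mod_cast hne.card_pos)]
    exact this
  have hpair : ∑ x ∈ S, ∑ x' ∈ S, v x * v x' * ‖x - x'‖ ^ 2 ≤ a ^ 2 * (1 - ∑ x ∈ S, v x ^ 2) := by
    calc _ ≤ ∑ x ∈ S, ∑ x' ∈ S, (v x * v x' * a ^ 2 - if x = x' then v x ^ 2 * a ^ 2 else 0) := by
          refine Finset.sum_le_sum fun x hx => Finset.sum_le_sum fun x' hx' => ?_
          split_ifs with h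
          · subst h; simp; nlinarith
          · rw [sub_zero]
            have := hdist x hx x' hx'
            rw [dist_eq_norm] at this
            have := hv0 x hx
            have := hv0 x' hx'
            gcongr
      _ = a ^ 2 * (1 - ∑ x ∈ S, v x ^ 2) := by
          simp only [Finset.sum_sub_distrib, Finset.sum_ite_eq, ← Finset.sum_mul,
            ← Finset.mul_sum, hw1]
          rw [Finset.sum_congr rfl fun x hx => if_pos hx, ← Finset.sum_mul]
          ring
  have ha : a ^ 2 * (1 - ∑ x ∈ S, v x ^ 2) ≤ a ^ 2 * (1 - 1 / S.card) := by gcongr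
  refine containmentRadius_unitBall_le (c := y) (Real.sqrt_nonneg _) fun p hp => ?_
  rw [mem_closedBall_iff_norm]
  refine Real.le_sqrt_of_sq_le ((hball p hp).trans ?_)
  linarith

/-- The circumradius of a simplex with all edges of length `a` is at least its known value. -/
theorem le_containmentRadius_equilateral {d : ℕ} (p : Fin (d + 1) → EuclideanSpace ℝ (Fin d))
    {a : ℝ} (ha : ∀ i j, i ≠ j → dist (p i) (p j) = a) :
    √(a ^ 2 / 2 * (1 - 1 / (d + 1))) ≤
      containmentRadius (convexHull ℝ (Set.range p)) (unitBall d) := by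
  classical
  refine le_containmentRadius_unitBall
    ((Set.finite_range p).isCompact_convexHull ℝ).isBounded fun c ρ hρ hc => ?_
  refine Real.sqrt_le_iff.2 ⟨hρ, ?_⟩
  have hd : (0 : ℝ) < d + 1 := by positivity
  have hw : ∑ _i : Fin (d + 1), (1 / (d + 1) : ℝ) = 1 := by
    simp; field_simp
  have hvar := sum_mul_norm_sub_sq_sub Finset.univ (fun _ => (1 / (d + 1) : ℝ)) p hw c
  have hpair : ∑ i, ∑ j, (1 / (d + 1) : ℝ) * (1 / (d + 1)) * ‖p i - p j‖ ^ 2 =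
      a ^ 2 * (1 - 1 / (d + 1)) := by
    have h : ∀ i j, (1 / (d + 1) : ℝ) * (1 / (d + 1)) * ‖p i - p j‖ ^ 2 =
        (1 / (d + 1) : ℝ) * (1 / (d + 1)) * a ^ 2 -
          if i = j then (1 / (d + 1) : ℝ) * (1 / (d + 1)) * a ^ 2 else 0 := by
      intro i j
      split_ifs with hij
      · simp [hij]
      · rw [← dist_eq_norm, ha i j hij, sub_zero]
    simp only [h, Finset.sum_sub_distrib, Finset.sum_ite_eq, Finset.mem_univ, if_true,
      Finset.sum_const, Finset.card_univ, Fintype.card_fin, nsmul_eq_mul]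
    push_cast
    field_simp
  have hle : ∑ i : Fin (d + 1), (1 / (d + 1) : ℝ) * ‖p i - c‖ ^ 2 ≤ ρ ^ 2 := by
    calc _ ≤ ∑ i : Fin (d + 1), (1 / (d + 1) : ℝ) * ρ ^ 2 := by
          gcongr with i
          exact mem_closedBall_iff_norm.1 (hc (subset_convexHull ℝ _ ⟨i, rfl⟩))
      _ = ρ ^ 2 := by rw [← Finset.sum_mul, hw, one_mul]
  have hsq := sq_nonneg ‖∑ i, (1 / (d + 1) : ℝ) • (p i - c)‖
  linarith

/-- The Gram matrix of the vertices of a regular simplex centred at the origin. -/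
theorem exists_inner_eq_regular_simplex (d : ℕ) :
    ∃ p : Fin (d + 1) → EuclideanSpace ℝ (Fin d),
      ∀ i j, inner ℝ (p i) (p j) = (if i = j then 1 else 0) - 1 / (d + 1 : ℝ) := by
  classical
  have : Fact (Module.finrank ℝ (EuclideanSpace ℝ (Fin (d + 1))) = d + 1) := ⟨by simp⟩
  have hd : (d + 1 : ℝ) ≠ 0 := by positivity
  set u : EuclideanSpace ℝ (Fin (d + 1)) := WithLp.toLp 2 fun _ => 1 with hu
  have huu : inner ℝ u u = (d + 1 : ℝ) := by
    rw [real_inner_self_eq_norm_sq, EuclideanSpace.norm_sq_eq]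
    simp [hu]
  have hu0 : u ≠ 0 := by
    intro h
    rw [h, inner_zero_left] at huu
    exact hd huu.symm
  have hue : ∀ i, inner ℝ u (EuclideanSpace.single i (1 : ℝ)) = 1 := by
    intro i; simp [hu, EuclideanSpace.inner_single_right]
  have hmem : ∀ i, EuclideanSpace.single i (1 : ℝ) - (1 / (d + 1 : ℝ)) • u ∈
      (Submodule.span ℝ {u})ᗮ := by
    intro i
    rw [Submodule.mem_orthogonal_singleton_iff_inner_right, inner_sub_right, inner_smul_right,
      hue, huu]
    field_simp
    ring
  -- The vertices are the standard basis vectors projected orthogonally to the all-ones vector.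
  refine ⟨fun i => (OrthonormalBasis.fromOrthogonalSpanSingleton (𝕜 := ℝ) d hu0).repr
    ⟨_, hmem i⟩, fun i j => ?_⟩
  rw [LinearIsometryEquiv.inner_map_map, Submodule.coe_inner]
  simp only [inner_sub_left, inner_sub_right, inner_smul_left, inner_smul_right, hue, huu,
    conj_trivial, real_inner_comm u]
  rw [EuclideanSpace.inner_single_left]
  simp [eq_comm]
  field_simp
  ring

/-- Transpositions generate all vertex permutations, and each is realized by the reflection
exchanging two vertices. -/
theorem exists_isRegularSimplex (d : ℕ) :
    ∃ T : Set (EuclideanSpace ℝ (Fin d)), IsRegularSimplex T := by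
  classical
  obtain ⟨p, hp⟩ := exists_inner_eq_regular_simplex d
  have hind : AffineIndependent ℝ p := by
    rw [affineIndependent_iff]
    intro s w hw hsum j hj
    have h := congrArg (fun x => inner ℝ x (p j)) hsum
    simp only [sum_inner, inner_smul_left, conj_trivial, hp, inner_zero_left, mul_sub,
      Finset.sum_sub_distrib, ← Finset.sum_mul, hw] at h
    simpa [hj] using h
  refine ⟨_, ⟨p, hind⟩, fun σ => ?_, rfl⟩
  change ∃ x : EuclideanSpace ℝ (Fin d) ≃ᵢ EuclideanSpace ℝ (Fin d), p ∘ σ = x ∘ p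
  induction σ using Equiv.Perm.swap_induction_on with
  | one => exact ⟨IsometryEquiv.refl _, rfl⟩
  | swap_mul f i j hij ih =>
    obtain ⟨x, hx⟩ := ih
    have hnorm : ‖p i‖ = ‖p j‖ := by
      rw [← sq_eq_sq₀ (norm_nonneg _) (norm_nonneg _), ← real_inner_self_eq_norm_sq,
        ← real_inner_self_eq_norm_sq, hp, hp, if_pos rfl, if_pos rfl]
    set R := (Submodule.span ℝ {p i - p j})ᗮ.reflection
    have hRi : R (p i) = p j := Submodule.reflection_sub hnorm
    have hswap : p ∘ Equiv.swap i j = R ∘ p := by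
      funext l
      simp only [Function.comp_apply]
      by_cases hli : l = i
      · rw [hli, Equiv.swap_apply_left, hRi]
      by_cases hlj : l = j
      · rw [hlj, Equiv.swap_apply_right, ← hRi, Submodule.reflection_reflection]
      rw [Equiv.swap_apply_of_ne_of_ne hli hlj, eq_comm, Submodule.reflection_eq_self_iff,
        Submodule.mem_orthogonal_singleton_iff_inner_left, inner_sub_right, hp, hp, if_neg hli,
        if_neg hlj, sub_self]
    refine ⟨x.trans R.toIsometryEquiv, ?_⟩
    rw [Equiv.Perm.coe_mul, ← Function.comp_assoc, hswap, Function.comp_assoc, hx]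
    rfl

/-! ### Core-set bounds -/

theorem exists_isCoreSet_encard_le {ε : ℝ} (hε : 0 < ε) {d : ℕ}
    {P : Set (EuclideanSpace ℝ (Fin d))} (hP : IsCompact P) :
    ∃ S : Set (EuclideanSpace ℝ (Fin d)), IsCoreSet ε (unitBall d) P S ∧
      S.encard ≤ ((⌈1 / (2 * ε + ε ^ 2)⌉₊ + 1 : ℕ) : ℕ∞) := by
  rcases P.eq_empty_or_nonempty with rfl | hne
  · have h0 := containmentRadius_unitBall_nonneg (∅ : Set (EuclideanSpace ℝ (Fin d)))
    exact ⟨∅, ⟨le_rfl, le_rfl, by nlinarith⟩, by simp⟩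
  · set k := ⌈1 / (2 * ε + ε ^ 2)⌉₊
    obtain ⟨S, hSP, hcard, hrad⟩ := exists_subset_containmentRadius_ge hP hne k
    refine ⟨S, ⟨hSP, containmentRadius_unitBall_mono hP.isBounded hSP, ?_⟩, hcard⟩
    have hkε : 1 ≤ k * (2 * ε + ε ^ 2) := by
      rw [← div_le_iff₀ (by positivity)]
      exact Nat.le_ceil _
    have hone : 1 ≤ (1 + ε) * √(k / (k + 1)) := by
      rw [← div_le_iff₀' (by positivity)]
      refine Real.le_sqrt_of_sq_le ?_
      rw [div_pow, div_le_div_iff₀ (by positivity) (by positivity)]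
      nlinarith
    calc containmentRadius P (unitBall d)
        ≤ (1 + ε) * √(k / (k + 1)) * containmentRadius P (unitBall d) :=
          le_mul_of_one_le_left (containmentRadius_unitBall_nonneg P) hone
      _ = (1 + ε) * (√(k / (k + 1)) * containmentRadius P (unitBall d)) := by ring
      _ ≤ _ := by gcongr

theorem exists_forall_isRegularSimplex_le_encard {ε : ℝ} (hε : 0 < ε) :
    ∃ D : ℕ, ∀ d : ℕ, D ≤ d → ∀ T : Set (EuclideanSpace ℝ (Fin d)), IsRegularSimplex T →
      ∀ S : Set (EuclideanSpace ℝ (Fin d)), IsCoreSet ε (unitBall d) T S →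
        ((⌈1 / (2 * ε + ε ^ 2)⌉₊ + 1 : ℕ) : ℕ∞) ≤ S.encard := by
  set k := ⌈1 / (2 * ε + ε ^ 2)⌉₊
  have hkpos : 0 < k := Nat.ceil_pos.2 (by positivity)
  have hk0 : (0 : ℝ) < k := by exact_mod_cast hkpos
  have hkε : (k - 1 : ℝ) * (2 * ε + ε ^ 2) < 1 := by
    rw [← lt_div_iff₀ (by positivity)]
    have := Nat.ceil_lt_add_one (a := 1 / (2 * ε + ε ^ 2)) (by positivity)
    linarith
  have hq : (1 + ε) ^ 2 * (1 - 1 / k) < 1 := by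
    have : (1 + ε) ^ 2 * (1 - 1 / k) = (1 + ε) ^ 2 * (k - 1) / k := by field_simp
    rw [this, div_lt_one hk0]
    nlinarith
  obtain ⟨D, hD⟩ := exists_nat_one_div_lt (sub_pos.2 hq)
  -- The extra `1` forces `d ≥ 1`, so that the edge length is positive.
  refine ⟨D + 1, fun d hd T hT S hS => ?_⟩
  obtain ⟨s, hreg, rfl⟩ := hT
  obtain ⟨a, ha⟩ := hreg.equilateral
  have hd1 : (D : ℝ) + 1 ≤ d := by exact_mod_cast hd
  have hD0 : (0 : ℝ) ≤ D := Nat.cast_nonneg D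
  have ha0 : 0 < a := by
    have h01 : (0 : Fin (d + 1)) ≠ Fin.last d := by
      intro h
      have := congrArg Fin.val h
      simp at this
      omega
    rw [← ha _ _ h01]
    exact dist_pos.2 (s.independent.injective.ne h01)
  have hdD : 1 / (d + 1 : ℝ) ≤ 1 / (D + 1) := by
    gcongr; linarith
  have hT := (le_containmentRadius_equilateral s.points ha).trans hS.2.2
  have hdlt : 1 / (d + 1 : ℝ) < 1 := by
    rw [div_lt_one (by positivity)]; linarith
  have hpos : 0 < a ^ 2 / 2 * (1 - 1 / (d + 1 : ℝ)) :=
    mul_pos (by positivity) (by linarith)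
  by_contra! hlt
  have hfin : S.Finite := Set.finite_of_encard_le_coe hlt.le
  lift S to Finset (EuclideanSpace ℝ (Fin d)) using hfin
  rw [Set.encard_coe_eq_coe_finsetCard, Nat.cast_lt, Nat.lt_succ_iff] at hlt
  rcases S.eq_empty_or_nonempty with rfl | hne
  · have h0 : containmentRadius ((∅ : Finset (EuclideanSpace ℝ (Fin d))) :
        Set (EuclideanSpace ℝ (Fin d))) (unitBall d) ≤ 0 :=
      containmentRadius_unitBall_le (c := 0) le_rfl (by simp)
    have := Real.sqrt_pos.2 hpos
    nlinarith
  -- Points of `S` need not be vertices, but the diameter of a convex hull is attained at vertices.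
  · have hdist : ∀ x ∈ S, ∀ y ∈ S, dist x y ≤ a := by
      intro x hx y hy
      obtain ⟨_, ⟨i, rfl⟩, _, ⟨j, rfl⟩, hij⟩ := convexHull_exists_dist_ge2 (hS.1 hx) (hS.1 hy)
      refine hij.trans ?_
      rcases eq_or_ne i j with rfl | h
      · simpa using ha0.le
      · exact (ha i j h).le
    have hle := hT.trans (mul_le_mul_of_nonneg_left (containmentRadius_finset_le S hne hdist)
      (by linarith))
    have hS0 : (0 : ℝ) < S.card := by exact_mod_cast hne.card_pos
    have hcard : 1 / (k : ℝ) ≤ 1 / S.card := by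
      gcongr
    have hS1 : 1 / (S.card : ℝ) ≤ 1 := by
      rw [div_le_one hS0]; exact_mod_cast hne.card_pos
    have hsq := pow_le_pow_left₀ (Real.sqrt_nonneg _) hle 2
    rw [mul_pow, Real.sq_sqrt hpos.le,
      Real.sq_sqrt (mul_nonneg (by positivity) (by linarith))] at hsq
    have h1 : 1 - 1 / (d + 1 : ℝ) ≤ (1 + ε) ^ 2 * (1 - 1 / S.card) := by
      refine le_of_mul_le_mul_left ?_ (by positivity : 0 < a ^ 2 / 2)
      linarith
    have h2 : (1 + ε) ^ 2 * (1 - 1 / (S.card : ℝ)) ≤ (1 + ε) ^ 2 * (1 - 1 / k) := by gcongr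
    linarith

theorem mainTheorem2 (ε : ℝ) (hε : 0 < ε) :
    -- every compact set has an `ε`-core-set of the claimed size
    (∀ (d : ℕ) (P : Set (EuclideanSpace ℝ (Fin d))), IsCompact P →
      ∃ S : Set (EuclideanSpace ℝ (Fin d)), IsCoreSet ε (unitBall d) P S ∧
        S.encard ≤ ((⌈1 / (2 * ε + ε ^ 2)⌉₊ + 1 : ℕ) : ℕ∞)) ∧
    -- no smaller number works in all dimensions
    (∀ m : ℕ,
      (∀ (d : ℕ) (P : Set (EuclideanSpace ℝ (Fin d))), IsCompact P →
        ∃ S : Set (EuclideanSpace ℝ (Fin d)), IsCoreSet ε (unitBall d) P S ∧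
          S.encard ≤ (m : ℕ∞)) →
      ⌈1 / (2 * ε + ε ^ 2)⌉₊ + 1 ≤ m) ∧
    -- this is witnessed by the regular simplices of all sufficiently high dimensions
    (∃ D : ℕ, ∀ d : ℕ, D ≤ d →
      (∃ T : Set (EuclideanSpace ℝ (Fin d)), IsRegularSimplex T) ∧
      ∀ T : Set (EuclideanSpace ℝ (Fin d)), IsRegularSimplex T →
        ∀ S : Set (EuclideanSpace ℝ (Fin d)), IsCoreSet ε (unitBall d) T S →
          ((⌈1 / (2 * ε + ε ^ 2)⌉₊ + 1 : ℕ) : ℕ∞) ≤ S.encard) := by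
  obtain ⟨D, hD⟩ := exists_forall_isRegularSimplex_le_encard hε
  refine ⟨fun d P hP => exists_isCoreSet_encard_le hε hP, fun m hm => ?_,
    D, fun d hd => ⟨exists_isRegularSimplex d, hD d hd⟩⟩
  obtain ⟨T, hT⟩ := exists_isRegularSimplex D
  have hTc : IsCompact T := by
    obtain ⟨s, -, rfl⟩ := hT
    exact (Set.finite_range s.points).isCompact_convexHull ℝ
  obtain ⟨S, hS, hcard⟩ := hm D T hTc
  exact_mod_cast (hD D le_rfl T hT S hS).trans hcard
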